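/- Let $1\le p<\infty$, and let $X=(X,d,\mu)$ be a metric space with a positive complete Borel measure $\mu$ (the completion of a measure on the Borel $\sigma$-algebra) such that $0<\mu(B)<\infty$ for all balls $B\subset X$. Write $B(x,r)=\{y:d(x,y)<r\}$. Assume that: (i) $X$ supports a global $1$-Poincaré inequality: there are constants $C_{PI}>0$ and $\lambda\ge1$ such that for all balls $B=B(x,r)$, all integrable $f$ on $X$ and all upper gradients $g$ of $f$, $$\frac1{\mu(B)}\int_B|f-f_B|\,d\mu\le C_{PI}\,r\,\frac1{\mu(\lambda B)}\int_{\lambda B}g\,d\mu,\qquad f_B=\frac1{\mu(B)}\int_B f\,d\mu,\quad \lambda B=B(x,\lambda r);$$ (ii) $\mu$ has the global $1$-annular decay property: there is a constant $C_{AD}>0$ such that for all $x\in X$ and $0<r<R$, $$\mu(B(x,R)\setminus B(x,r))\le C_{AD}\Bigl(1-\frac rR\Bigr)\mu(B(x,R)).$$ Here a Borel function $g:X\to[0,\infty]$ is an upper gradient of $f$ if $|f(\gamma(0))-f(\gamma(l_\gamma))|\le\int_\gamma g\,ds$ for every nonconstant compact rectifiable curve $\gamma:[0,l_\gamma]\to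 X$ parametrized by arc length (the left-hand side being $\infty$ if one of its terms is infinite); a measurable $g:X\to[0,\infty]$ is a $p$-weak upper gradient of $f$ if this holds for all such curves outside a family $\Gamma$ for which there is $0\le\rho\in L^p(X)$ with $\int_\gamma\rho\,ds=\infty$ for all $\gamma\in\Gamma$. The space $N^{1,p}(X)$ consists of the everywhere defined measurable functions in $L^p(X)$ having an upper gradient in $L^p(X)$; each $u\in N^{1,p}(X)$ has a minimal $p$-weak upper gradient $g_u$, i.e. an a.e. smallest one among those in $L^p(X)$. For $E\subset\Omega$ with $\Omega$ open, $$\operatorname{cap}_p(E,\Omega)=\inf_u\int_\Omega g_u^p\,d\mu,$$ the infimum being over all $u\in N^{1,p}(X)$ with $\chi_E\le u\le1$ in $\Omega$ and $u=0$ on $X\setminus\Omega$. Then there is a constant $A>0$, depending only on $p$, $C_{PI}$, $\lambda$ and $C_{AD}$ (in particular not on $x_0$, $r$, $R$), such that for every $x_0\in X$, with $B_\rho=B(x_0,\rho)$, $$\frac1A\Bigl(1-\frac rR\Bigr)^{1-p}\frac{\mu(B_R)}{R^p}\le\operatorname{cap}_p(B_r,B_R)\le A\Bigl(1-\frac rR\Bigr)^{1-p}\frac{\mu(B_R)}{R^p}\qquad\text{whenever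 } 0<\frac R2\le r<R\le\frac{\operatorname{diam}X}{3}.$$ -/

import Mathlib

open MeasureTheory Set
open scoped ENNReal

noncomputable section

namespace ThinAnnuli

/-- A nonconstant compact rectifiable curve in `X`, parametrized by arc length on `[0, length]`
(only the values of `toFun` on this interval matter). Having unit speed means that the length of
the restriction to any `[s, t] ⊆ [0, length]` is `t - s`; in particular the curve is `1`-Lipschitz,
has finite length `length`, and it is nonconstant because `0 < length`. -/
structure Curve (X : Type*) [MetricSpace X] where
  toFun : ℝ → X
  length : ℝ
  length_pos : 0 < length
  unitSpeed : HasUnitSpeedOn toFun (Icc 0 length)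

/-- The line integral `∫_γ g ds` of a nonnegative function. -/
def Curve.lineIntegral {X : Type*} [MetricSpace X] (γ : Curve X) (g : X → ℝ≥0∞) : ℝ≥0∞ :=
  ∫⁻ t in Icc 0 γ.length, g (γ.toFun t)

/-- The upper gradient inequality for `f` and `g` along the curve `γ`. -/
def UpperGradientIneq {X : Type*} [MetricSpace X] (f : X → ℝ) (g : X → ℝ≥0∞) (γ : Curve X) :
    Prop :=
  ENNReal.ofReal |f (γ.toFun 0) - f (γ.toFun γ.length)| ≤ γ.lineIntegral g

/-- The Borel function `g : X → [0, ∞]` is an upper gradient of `f`. -/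
def IsUpperGradient {X : Type*} [MetricSpace X] [MeasurableSpace X]
    (f : X → ℝ) (g : X → ℝ≥0∞) : Prop :=
  Measurable g ∧ ∀ γ : Curve X, UpperGradientIneq f g γ

/-- The curve family `Γ` has zero `p`-modulus: for some nonnegative `ρ ∈ L^p(X)`, the integral of
`ρ` along every curve of the family is infinite. -/
def ZeroModulus {X : Type*} [MetricSpace X] [MeasurableSpace X]
    (μ : Measure X) (p : ℝ) (Γ : Set (Curve X)) : Prop :=
  ∃ ρ : X → ℝ≥0∞, Measurable ρ ∧ ∫⁻ x, ρ x ^ p ∂μ < ∞ ∧ ∀ γ ∈ Γ, γ.lineIntegral ρ = ∞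

/-- `g : X → [0, ∞]` is a `p`-weak upper gradient of `f`. Measurability refers to the completion
of the Borel measure `μ`, which is what `AEMeasurable` expresses. -/
def IsWeakUpperGradient {X : Type*} [MetricSpace X] [MeasurableSpace X]
    (μ : Measure X) (p : ℝ) (f : X → ℝ) (g : X → ℝ≥0∞) : Prop :=
  AEMeasurable g μ ∧ ZeroModulus μ p {γ : Curve X | ¬ UpperGradientIneq f g γ}

/-- `f` belongs to the Newtonian space `N^{1,p}(X)`: it is in `L^p` and has an upper gradient
in `L^p`. -/
def MemNewtonian {X : Type*} [MetricSpace X] [MeasurableSpace X]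
    (μ : Measure X) (p : ℝ) (f : X → ℝ) : Prop :=
  AEMeasurable f μ ∧ ∫⁻ x, ENNReal.ofReal |f x| ^ p ∂μ < ∞ ∧
    ∃ g : X → ℝ≥0∞, IsUpperGradient f g ∧ ∫⁻ x, g x ^ p ∂μ < ∞

/-- The energy `∫_Ω g_u^p dμ` of `u ∈ N^{1,p}(X)`, where `g_u` is the minimal `p`-weak upper
gradient of `u`. Since `g_u` is, up to a null set, the smallest `p`-weak upper gradient of `u` in
`L^p(X)`, this is the least value of `∫_Ω g^p dμ` over all such upper gradients `g`. -/
def energy {X : Type*} [MetricSpace X] [MeasurableSpace X]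
    (μ : Measure X) (p : ℝ) (Ω : Set X) (u : X → ℝ) : ℝ≥0∞ :=
  ⨅ (g : X → ℝ≥0∞) (_ : IsWeakUpperGradient μ p u g ∧ ∫⁻ x, g x ^ p ∂μ < ∞),
    ∫⁻ x in Ω, g x ^ p ∂μ

/-- `u` is admissible for the variational capacity of `E` with respect to `Ω`. -/
def Admissible {X : Type*} [MetricSpace X] [MeasurableSpace X]
    (μ : Measure X) (p : ℝ) (E Ω : Set X) (u : X → ℝ) : Prop :=
  MemNewtonian μ p u ∧ (∀ x ∈ Ω, E.indicator 1 x ≤ u x ∧ u x ≤ 1) ∧ ∀ x ∉ Ω, u x = 0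

/-- The variational `p`-capacity `cap_p(E, Ω)`. -/
def variationalCapacity {X : Type*} [MetricSpace X] [MeasurableSpace X]
    (μ : Measure X) (p : ℝ) (E Ω : Set X) : ℝ≥0∞ :=
  ⨅ (u : X → ℝ) (_ : Admissible μ p E Ω u), energy μ p Ω u

/-- `X` supports a `q`-Poincaré inequality at `x` with constant `C` and dilation `lam`. It is
required only for (genuine) upper gradients and for finite-valued functions, which is equivalent
to requiring it also for `q`-weak upper gradients and extended real-valued functions. -/
def PoincareAt {X : Type*} [MetricSpace X] [MeasurableSpace X]
    (μ : Measure X) (q C lam : ℝ) (x : X) : Prop :=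
  ∀ r : ℝ, 0 < r → ∀ (f : X → ℝ) (g : X → ℝ≥0∞), Integrable f μ → IsUpperGradient f g →
    ⨍⁻ y in Metric.ball x r, ENNReal.ofReal |f y - ⨍ z in Metric.ball x r, f z ∂μ| ∂μ
      ≤ ENNReal.ofReal (C * r) * (⨍⁻ y in Metric.ball x (lam * r), g y ^ q ∂μ) ^ (1 / q)

/-- `μ` has the `η`-annular decay property at `x` with constant `C`. -/
def AnnularDecayAt {X : Type*} [MetricSpace X] [MeasurableSpace X]
    (μ : Measure X) (η C : ℝ) (x : X) : Prop :=
  ∀ r R : ℝ, 0 < r → r < R →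
    μ (Metric.ball x R \ Metric.ball x r)
      ≤ ENNReal.ofReal (C * (1 - r / R) ^ η) * μ (Metric.ball x R)

end ThinAnnuli

end

/-! Upper bound: the radial cutoff that is linear in the distance to the centre has upper gradient
`(R - r)⁻¹` on the annulus `S = B_R \ B_r` and zero elsewhere. Its energy is at most `(R - r)^(-p) *
μ S`, and annular decay bounds `μ S` by `(1 - r/R) * μ B_R` up to a constant.

Lower bound: an admissible `u` is `1` on `B_r` and `0` off `B_R`, so only the part of its gradient
`g` in `S` matters (`ControlsOn.indicator_compl`). The 1-Poincaré inequality on `B_{2R}`, tested on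
`B_r` and on a ball `B(y, R/4)` outside `B_R`, gives `μ B_R ≲ R ∫_S g`
(`measure_ball_le_lintegral_annulus`). Hölder's inequality on `S` together with annular decay then
produces the factor `(1 - r/R)^(p - 1)`.

Two facts support this. Annular decay implies doubling, which makes the two test balls comparable
with `B_R`. The Poincaré inequality excludes empty annuli, which with the diameter bound supplies
`y`. -/

namespace ThinAnnuli

/-! ### Discarding level sets in one variable -/

/-- `h` dominates the oscillation of `v` on every subinterval of `[a, b]`. -/
def ControlsOn (v : ℝ → ℝ) (h : ℝ → ℝ≥0∞) (a b : ℝ) : Prop :=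
  ∀ s t : ℝ, a ≤ s → s ≤ t → t ≤ b → ENNReal.ofReal |v s - v t| ≤ ∫⁻ τ in Icc s t, h τ

theorem setLIntegral_Ico_add_Icc (h : ℝ → ℝ≥0∞) {a b c : ℝ} (hab : a ≤ b) (hbc : b ≤ c) :
    ∫⁻ τ in Icc a c, h τ = (∫⁻ τ in Ico a b, h τ) + ∫⁻ τ in Icc b c, h τ := by
  rw [← lintegral_union measurableSet_Icc, Ico_union_Icc_eq_Icc hab hbc]
  exact disjoint_left.2 fun x hx hy => not_le.2 hx.2 hy.1

theorem setLIntegral_Icc_add_Ioc (h : ℝ → ℝ≥0∞) {a b c : ℝ} (hab : a ≤ b) (hbc : b ≤ c) :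
    ∫⁻ τ in Icc a c, h τ = (∫⁻ τ in Icc a b, h τ) + ∫⁻ τ in Ioc b c, h τ := by
  rw [← lintegral_union measurableSet_Ioc, Icc_union_Ioc_eq_Icc hab hbc]
  exact disjoint_left.2 fun x hx hy => not_le.2 hy.1 hx.2

/-- The integrand controlling `v` may be dropped on a set where `v` is constant. -/
theorem ControlsOn.indicator_compl {v : ℝ → ℝ} {h : ℝ → ℝ≥0∞} {a b : ℝ}
    (hv : ControlsOn v h a b) (hfin : ∫⁻ τ in Icc a b, h τ ≠ ∞) {T : Set ℝ} {c : ℝ}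
    (hT : ∀ t ∈ T, a ≤ t → t ≤ b → v t = c) : ControlsOn v (Tᶜ.indicator h) a b := by
  intro s t has hst htb
  rcases (T ∩ Icc s t).eq_empty_or_nonempty with he | hne
  · refine (hv s t has hst htb).trans_eq (setLIntegral_congr_fun measurableSet_Icc ?_)
    intro τ hτ
    rw [indicator_of_mem]
    exact fun hτT => (he.subset ⟨hτT, hτ⟩ : τ ∈ (∅ : Set ℝ))
  set T' := T ∩ Icc s t
  have hbb : BddBelow T' := ⟨s, fun τ hτ => hτ.2.1⟩
  have hba : BddAbove T' := ⟨t, fun τ hτ => hτ.2.2⟩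
  -- Only the first and last visits to `T` count: `v = c` at both, so the oscillation between them
  -- costs nothing. They need not be attained, hence the approximation by `small`, the absolute
  -- continuity of the integral.
  set s₁ := sInf T'
  set s₂ := sSup T'
  have h₁ : s ≤ s₁ := le_csInf hne fun τ hτ => hτ.2.1
  have h₂ : s₂ ≤ t := csSup_le hne fun τ hτ => hτ.2.2
  have h₁₂ : s₁ ≤ s₂ := csInf_le_csSup hne hbb hba
  have small : ∀ ε : NNReal, 0 < ε → ∃ δ : ℝ, 0 < δ ∧ ∀ x y : ℝ, a ≤ x → y ≤ b → y - x < δ →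
      ∫⁻ τ in Icc x y, h τ ≤ ε := by
    intro ε hε
    obtain ⟨δ, hδ, H⟩ := exists_pos_setLIntegral_lt_of_measure_lt hfin
      (ε := (ε : ℝ≥0∞)) (by exact_mod_cast hε.ne')
    obtain ⟨η, hη, hηδ⟩ := ENNReal.lt_iff_exists_nnreal_btwn.1 hδ
    refine ⟨η, by exact_mod_cast hη, fun x y hx hy hxy => ?_⟩
    have := H (Icc x y) (lt_of_le_of_lt (Measure.restrict_apply_le _ _) ?_)
    · rw [Measure.restrict_restrict measurableSet_Icc,
        inter_eq_left.2 (Icc_subset_Icc hx hy)] at this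
      exact this.le
    · rw [Real.volume_Icc]
      refine lt_of_le_of_lt ?_ hηδ
      rw [← ENNReal.ofReal_coe_nnreal]
      exact ENNReal.ofReal_le_ofReal hxy.le
  have left : ENNReal.ofReal |v s - c| ≤ ∫⁻ τ in Ico s s₁, h τ := by
    refine ENNReal.le_of_forall_pos_le_add fun ε hε _ => ?_
    obtain ⟨δ, hδ, H⟩ := small ε hε
    obtain ⟨τ, hτ, hτδ⟩ := exists_lt_of_csInf_lt hne (lt_add_of_pos_right s₁ hδ)
    have hs₁τ : s₁ ≤ τ := csInf_le hbb hτ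
    have hτb : τ ≤ b := hτ.2.2.trans htb
    have := hv s τ has hτ.2.1 hτb
    rw [hT τ hτ.1 (has.trans hτ.2.1) hτb, setLIntegral_Ico_add_Icc h h₁ hs₁τ] at this
    exact this.trans (add_le_add le_rfl (H s₁ τ (has.trans h₁) hτb (by linarith)))
  have right : ENNReal.ofReal |c - v t| ≤ ∫⁻ τ in Ioc s₂ t, h τ := by
    refine ENNReal.le_of_forall_pos_le_add fun ε hε _ => ?_
    obtain ⟨δ, hδ, H⟩ := small ε hε
    obtain ⟨τ, hτ, hτδ⟩ := exists_lt_of_lt_csSup hne (sub_lt_self s₂ hδ)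
    have hs₂τ : τ ≤ s₂ := le_csSup hba hτ
    have haτ : a ≤ τ := has.trans hτ.2.1
    have := hv τ t haτ hτ.2.2 htb
    rw [hT τ hτ.1 haτ (hτ.2.2.trans htb), setLIntegral_Icc_add_Ioc h hs₂τ h₂, add_comm] at this
    exact this.trans (add_le_add le_rfl (H τ s₂ haτ (h₂.trans htb) (by linarith)))
  have tri : ENNReal.ofReal |v s - v t| ≤ ENNReal.ofReal |v s - c| + ENNReal.ofReal |c - v t| := by
    rw [← ENNReal.ofReal_add (abs_nonneg _) (abs_nonneg _)]
    exact ENNReal.ofReal_le_ofReal (abs_sub_le _ _ _)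
  have hleft : ∫⁻ τ in Ico s s₁, h τ = ∫⁻ τ in Ico s s₁, Tᶜ.indicator h τ := by
    refine setLIntegral_congr_fun measurableSet_Ico fun τ hτ => ?_
    rw [indicator_of_mem]
    exact fun hτT => not_le.2 hτ.2 (csInf_le hbb ⟨hτT, hτ.1, hτ.2.le.trans (h₁₂.trans h₂)⟩)
  have hright : ∫⁻ τ in Ioc s₂ t, h τ = ∫⁻ τ in Ioc s₂ t, Tᶜ.indicator h τ := by
    refine setLIntegral_congr_fun measurableSet_Ioc fun τ hτ => ?_
    rw [indicator_of_mem]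
    exact fun hτT => not_le.2 hτ.1 (le_csSup hba ⟨hτT, (h₁.trans h₁₂).trans hτ.1.le, hτ.2⟩)
  calc ENNReal.ofReal |v s - v t|
      ≤ (∫⁻ τ in Ico s s₁, Tᶜ.indicator h τ) + ∫⁻ τ in Ioc s₂ t, Tᶜ.indicator h τ := by
        rw [← hleft, ← hright]; exact tri.trans (add_le_add left right)
    _ = ∫⁻ τ in Ico s s₁ ∪ Ioc s₂ t, Tᶜ.indicator h τ := by
        rw [lintegral_union measurableSet_Ioc]
        exact disjoint_left.2 fun x hx hy => absurd (hx.2.trans_le h₁₂) (not_lt.2 hy.1.le)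
    _ ≤ ∫⁻ τ in Icc s t, Tᶜ.indicator h τ := by
        refine lintegral_mono_set (union_subset ?_ ?_)
        · exact fun x hx => ⟨hx.1, hx.2.le.trans (h₁₂.trans h₂)⟩
        · exact fun x hx => ⟨(h₁.trans h₁₂).trans hx.1.le, hx.2⟩

/-! ### Arc-length curves and their subcurves -/

section Curves

variable {X : Type*} [MetricSpace X]

theorem Curve.dist_le (γ : Curve X) {s t : ℝ} (hs : 0 ≤ s) (hst : s ≤ t) (ht : t ≤ γ.length) :
    dist (γ.toFun s) (γ.toFun t) ≤ t - s := by
  have hsm : s ∈ Icc 0 γ.length := ⟨hs, hst.trans ht⟩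
  have htm : t ∈ Icc 0 γ.length := ⟨hs.trans hst, ht⟩
  have h := eVariationOn.edist_le γ.toFun (s := Icc 0 γ.length ∩ Icc s t) ⟨hsm, le_rfl, hst⟩
    ⟨htm, hst, le_rfl⟩
  rw [γ.unitSpeed hsm htm, edist_dist, NNReal.coe_one, one_mul] at h
  exact (ENNReal.ofReal_le_ofReal_iff (by linarith)).1 h

theorem Curve.continuousOn (γ : Curve X) : ContinuousOn γ.toFun (Icc 0 γ.length) := by
  refine (LipschitzOnWith.of_dist_le_mul (K := 1) fun s hs t ht => ?_).continuousOn
  rw [NNReal.coe_one, one_mul, Real.dist_eq]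
  rcases le_total s t with h | h
  · rw [abs_sub_comm]
    exact (γ.dist_le hs.1 h ht.2).trans (le_abs_self _)
  · rw [dist_comm]
    exact (γ.dist_le ht.1 h hs.2).trans (le_abs_self _)

/-- The restriction of a curve to `[s, t]`, reparametrized by `[0, t - s]`. -/
def Curve.sub (γ : Curve X) (s t : ℝ) (hs : 0 ≤ s) (hst : s < t) (ht : t ≤ γ.length) :
    Curve X where
  toFun := γ.toFun ∘ fun τ => s + τ
  length := t - s
  length_pos := sub_pos.2 hst
  unitSpeed := by
    intro x hx y hy
    rw [eVariationOn.comp_eq_of_monotoneOn _ _ (fun _ _ _ _ h => add_le_add le_rfl h)]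
    have hxm : s + x ∈ Icc 0 γ.length := ⟨by linarith [hx.1], by linarith [hx.2]⟩
    have hym : s + y ∈ Icc 0 γ.length := ⟨by linarith [hy.1], by linarith [hy.2]⟩
    have h := γ.unitSpeed hxm hym
    rw [show s + y - (s + x) = y - x by ring] at h
    rw [← h]
    congr 1
    ext z
    simp only [mem_image, mem_inter_iff, mem_Icc]
    constructor
    · rintro ⟨w, ⟨⟨h1, h2⟩, h3, h4⟩, rfl⟩
      exact ⟨⟨by linarith, by linarith⟩, by linarith, by linarith⟩
    · rintro ⟨⟨h1, h2⟩, h3, h4⟩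
      exact ⟨z - s, ⟨⟨by linarith [hx.1], by linarith [hy.2]⟩, by linarith, by linarith⟩, by ring⟩

theorem Curve.lineIntegral_sub (γ : Curve X) {s t : ℝ} (hs : 0 ≤ s) (hst : s < t)
    (ht : t ≤ γ.length) (g : X → ℝ≥0∞) :
    (γ.sub s t hs hst ht).lineIntegral g = ∫⁻ τ in Icc s t, g (γ.toFun τ) := by
  rw [← (measurePreserving_add_left volume s).setLIntegral_comp_preimage_emb
    (measurableEmbedding_addLeft s) (fun τ => g (γ.toFun τ)) (Icc s t)]
  simp [Curve.lineIntegral, Curve.sub]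

theorem controlsOn_of_forall_sub {f : X → ℝ} {g : X → ℝ≥0∞} (γ : Curve X)
    (h : ∀ (s t : ℝ) (hs : 0 ≤ s) (hst : s < t) (ht : t ≤ γ.length),
      UpperGradientIneq f g (γ.sub s t hs hst ht)) :
    ControlsOn (fun t => f (γ.toFun t)) (fun t => g (γ.toFun t)) 0 γ.length := by
  intro s t hs hst ht
  rcases hst.eq_or_lt with rfl | hlt
  · simp
  · have := h s t hs hlt ht
    rw [UpperGradientIneq, Curve.lineIntegral_sub] at this
    simpa [Curve.sub] using this

theorem UpperGradientIneq.mono {f : X → ℝ} {g h : X → ℝ≥0∞} {γ : Curve X}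
    (hf : UpperGradientIneq f g γ) (hgh : ∀ x, g x ≤ h x) : UpperGradientIneq f h γ :=
  hf.trans (lintegral_mono fun _ => hgh _)

/-- If `f` is controlled along `γ` by `g` and constant on each of two sets, then the upper gradient
inequality only needs the values of `g` off both sets. -/
theorem upperGradientIneq_indicator {f : X → ℝ} {g : X → ℝ≥0∞} (γ : Curve X)
    (h : ControlsOn (fun t => f (γ.toFun t)) (fun t => g (γ.toFun t)) 0 γ.length)
    (hfin : γ.lineIntegral g ≠ ∞) {U V : Set X} {c d : ℝ} (hU : ∀ x ∈ U, f x = c)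
    (hV : ∀ x ∈ V, f x = d) : UpperGradientIneq f ((Vᶜ \ U).indicator g) γ := by
  -- The cut applies to one level set at a time; its conclusion is again a `ControlsOn`, so it can
  -- be iterated.
  have h₁ := h.indicator_compl hfin (T := γ.toFun ⁻¹' U) (c := c) fun t ht _ _ => hU _ ht
  have hfin' : ∫⁻ τ in Icc 0 γ.length,
      (γ.toFun ⁻¹' U)ᶜ.indicator (fun t => g (γ.toFun t)) τ ≠ ∞ :=
    ne_top_of_le_ne_top hfin (lintegral_mono fun _ => indicator_le_self _ _ _)
  have h₂ := h₁.indicator_compl hfin' (T := γ.toFun ⁻¹' V) (c := d) fun t ht _ _ => hV _ ht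
  refine (h₂ 0 γ.length le_rfl γ.length_pos.le le_rfl).trans_eq ?_
  refine lintegral_congr fun t => ?_
  by_cases h1 : γ.toFun t ∈ U <;> by_cases h2 : γ.toFun t ∈ V <;> simp [indicator, h1, h2]

end Curves

/-! ### Measurable majorants and Hölder's inequality -/

section Measure

variable {X : Type*} [MeasurableSpace X] {μ : Measure X} {p : ℝ}

/-- Domination must hold everywhere, since a curve may run inside a null set. A Borel majorant is
obtained by putting `∞` on a measurable null set containing all points where the Borel
representative differs. -/
theorem exists_measurable_ge_ae_eq {g : X → ℝ≥0∞} (hg : AEMeasurable g μ) :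
    ∃ g' : X → ℝ≥0∞, Measurable g' ∧ (∀ x, g x ≤ g' x) ∧ g' =ᵐ[μ] g := by
  classical
  obtain ⟨N, hN, hNm, hN0⟩ := exists_measurable_superset_of_null (ae_iff.1 hg.ae_eq_mk)
  refine ⟨fun x => if x ∈ N then ∞ else hg.mk g x, Measurable.ite hNm measurable_const
    hg.measurable_mk, fun x => ?_, ?_⟩
  · dsimp only
    split_ifs with hx
    · exact le_top
    · have : g x = hg.mk g x := by
        by_contra hne
        exact hx (hN hne)
      exact this.le
  · have : ∀ᵐ x ∂μ, x ∉ N := measure_eq_zero_iff_ae_notMem.1 hN0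
    filter_upwards [this, hg.ae_eq_mk] with x hx hgx
    rw [if_neg hx, hgx]

theorem rpow_lintegral_le_mul_measure (hp : 1 ≤ p) {g : X → ℝ≥0∞} (hg : AEMeasurable g μ)
    (S : Set X) :
    (∫⁻ x in S, g x ∂μ) ^ p ≤ (∫⁻ x in S, g x ^ p ∂μ) * μ S ^ (p - 1) := by
  have hp0 : 0 < p := by linarith
  have h := eLpNorm'_le_eLpNorm'_mul_rpow_measure_univ (μ := μ.restrict S) (p := 1) (q := p)
    one_pos hp hg.restrict.aestronglyMeasurable
  simp only [eLpNorm'_eq_lintegral_enorm, enorm_eq_self, ENNReal.rpow_one, div_one,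
    Measure.restrict_apply_univ] at h
  have h' := ENNReal.rpow_le_rpow h hp0.le
  rw [ENNReal.mul_rpow_of_nonneg _ _ hp0.le, ← ENNReal.rpow_mul, ← ENNReal.rpow_mul,
    one_div_mul_cancel hp0.ne', ENNReal.rpow_one, sub_mul, one_mul, one_div_mul_cancel hp0.ne'] at h'
  exact h'

theorem lintegral_lt_top_of_rpow (hp : 1 ≤ p) {g : X → ℝ≥0∞} {S : Set X} (hS : μ S < ∞)
    (hg : ∫⁻ x, g x ^ p ∂μ < ∞) : ∫⁻ x in S, g x ∂μ < ∞ := by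
  have hle : ∀ t : ℝ≥0∞, t ≤ 1 + t ^ p := fun t => by
    rcases le_total t 1 with h | h
    · exact h.trans le_self_add
    · exact (ENNReal.le_rpow_self_of_one_le h hp).trans le_add_self
  calc ∫⁻ x in S, g x ∂μ ≤ ∫⁻ x in S, (1 + g x ^ p) ∂μ := lintegral_mono fun x => hle _
    _ = μ S + ∫⁻ x in S, g x ^ p ∂μ := by
      rw [lintegral_add_left measurable_const]; simp
    _ < ∞ := ENNReal.add_lt_top.2 ⟨hS, (setLIntegral_le_lintegral _ _).trans_lt hg⟩

end Measure

/-! ### From weak to genuine upper gradients -/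

section Newtonian

variable {X : Type*} [MetricSpace X] [MeasurableSpace X] {μ : Measure X} {p : ℝ}

/-- A weak upper gradient can be cut off on two sets where the function is constant, and then
turned into a genuine upper gradient by an arbitrarily small perturbation. -/
theorem IsWeakUpperGradient.exists_isUpperGradient_cutoff {f : X → ℝ} {g : X → ℝ≥0∞}
    (hg : IsWeakUpperGradient μ p f g) {U V : Set X} (hUm : MeasurableSet U)
    (hVm : MeasurableSet V) {c d : ℝ} (hU : ∀ x ∈ U, f x = c) (hV : ∀ x ∈ V, f x = d) :
    ∃ g' ρ : X → ℝ≥0∞, Measurable g' ∧ g' =ᵐ[μ] g ∧ Measurable ρ ∧ ∫⁻ x, ρ x ^ p ∂μ < ∞ ∧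
      ∀ ε : ℝ≥0∞, ε ≠ 0 →
        IsUpperGradient f fun x => (Vᶜ \ U).indicator g' x + ε * (g' x + ρ x) := by
  obtain ⟨hgm, ρ, hρm, hρ, hΓ⟩ := hg
  obtain ⟨g', hg'm, hle, hae⟩ := exists_measurable_ge_ae_eq hgm
  refine ⟨g', ρ, hg'm, hae, hρm, hρ, fun ε hε => ⟨(hg'm.indicator (hVm.compl.diff hUm)).add
    ((hg'm.add hρm).const_mul ε), fun γ => ?_⟩⟩
  -- Along curves where `g' + ρ` has infinite integral the `ε` term alone suffices. On the others
  -- every subcurve is good, because a bad one would already carry an infinite integral of `ρ`.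
  by_cases hfin : γ.lineIntegral (fun x => g' x + ρ x) = ∞
  · have : γ.lineIntegral (fun x => (Vᶜ \ U).indicator g' x + ε * (g' x + ρ x)) = ∞ := by
      refine top_le_iff.1 ?_
      calc ∞ = ε * γ.lineIntegral (fun x => g' x + ρ x) := by rw [hfin, ENNReal.mul_top hε]
        _ ≤ ∫⁻ t in Icc 0 γ.length, ε * (g' (γ.toFun t) + ρ (γ.toFun t)) :=
          lintegral_const_mul_le _ _
        _ ≤ _ := lintegral_mono fun t => le_add_self
    rw [UpperGradientIneq, this]
    exact le_top
  · have hg'fin : γ.lineIntegral g' ≠ ∞ :=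
      ne_top_of_le_ne_top hfin (lintegral_mono fun t => le_self_add)
    have hρfin : γ.lineIntegral ρ ≠ ∞ :=
      ne_top_of_le_ne_top hfin (lintegral_mono fun t => le_add_self)
    refine UpperGradientIneq.mono (upperGradientIneq_indicator γ
      (controlsOn_of_forall_sub γ fun s t hs hst ht => ?_) hg'fin hU hV) fun x => le_self_add
    by_contra hbad
    have hbad' : ¬ UpperGradientIneq f g (γ.sub s t hs hst ht) := fun h => hbad (h.mono hle)
    have := hΓ _ hbad'
    rw [Curve.lineIntegral_sub] at this
    exact hρfin (top_le_iff.1 (this.ge.trans (lintegral_mono_set (Icc_subset_Icc hs ht))))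

end Newtonian

end ThinAnnuli

namespace ThinAnnuli

/-! ### Points far from the centre, and the radial cutoff -/

section Metric

variable {X : Type*} [MetricSpace X]

theorem exists_dist_gt_of_ediam {x : X} {R s : ℝ} (hs : 0 ≤ s) (hsR : 2 * s < 3 * R)
    (hdiam : ENNReal.ofReal R ≤ Metric.ediam (univ : Set X) / 3) : ∃ z, s < dist z x := by
  by_contra! hall
  have hle : Metric.ediam (univ : Set X) ≤ ENNReal.ofReal (2 * s) := by
    refine Metric.ediam_le fun y _ z _ => ?_
    rw [edist_dist]
    refine ENNReal.ofReal_le_ofReal ?_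
    have := dist_triangle_right y z x
    linarith [hall y, hall z]
  rw [ENNReal.le_div_iff_mul_le (by simp) (by simp)] at hdiam
  have h3 : ENNReal.ofReal (R * 3) ≤ ENNReal.ofReal (2 * s) := by
    rw [ENNReal.ofReal_mul' (by norm_num : (0 : ℝ) ≤ 3)]
    simpa using hdiam.trans hle
  rw [ENNReal.ofReal_le_ofReal_iff (by linarith)] at h3
  linarith

/-- The radial cutoff function, equal to `1` on `B(x₀, r)` and to `0` off `B(x₀, R)`. -/
noncomputable def radialCutoff (x₀ : X) (r R : ℝ) (x : X) : ℝ :=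
  min 1 (max 0 ((R - dist x x₀) / (R - r)))

theorem abs_radialCutoff_sub_le (x₀ : X) {r R : ℝ} (hrR : r < R) (x y : X) :
    |radialCutoff x₀ r R x - radialCutoff x₀ r R y| ≤ (R - r)⁻¹ * dist x y := by
  have hpos : 0 < R - r := sub_pos.2 hrR
  refine (abs_min_sub_min_le_max _ _ _ _).trans ?_
  rw [sub_self, abs_zero, max_eq_right (abs_nonneg _)]
  refine (abs_max_sub_max_le_max _ _ _ _).trans ?_
  rw [sub_self, abs_zero, max_eq_right (abs_nonneg _), ← sub_div, abs_div, abs_of_pos hpos,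
    div_eq_inv_mul]
  refine mul_le_mul_of_nonneg_left ?_ (inv_pos.2 hpos).le
  rw [show R - dist x x₀ - (R - dist y x₀) = dist y x₀ - dist x x₀ by ring, dist_comm x y]
  exact abs_dist_sub_le _ _ _

theorem radialCutoff_eq_one {x₀ : X} {r R : ℝ} (hrR : r < R) {x : X}
    (hx : x ∈ Metric.ball x₀ r) : radialCutoff x₀ r R x = 1 := by
  rw [Metric.mem_ball] at hx
  have : 1 ≤ (R - dist x x₀) / (R - r) := by
    rw [one_le_div (sub_pos.2 hrR)]; linarith
  exact min_eq_left (this.trans (le_max_right _ _))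

theorem radialCutoff_eq_zero {x₀ : X} {r R : ℝ} (hrR : r < R) {x : X}
    (hx : x ∉ Metric.ball x₀ R) : radialCutoff x₀ r R x = 0 := by
  rw [Metric.mem_ball, not_lt] at hx
  have : (R - dist x x₀) / (R - r) ≤ 0 :=
    div_nonpos_of_nonpos_of_nonneg (by linarith) (by linarith)
  rw [radialCutoff, max_eq_left this, min_eq_right zero_le_one]

theorem radialCutoff_nonneg (x₀ : X) (r R : ℝ) (x : X) : 0 ≤ radialCutoff x₀ r R x :=
  le_min zero_le_one (le_max_left _ _)

theorem radialCutoff_le_one (x₀ : X) (r R : ℝ) (x : X) : radialCutoff x₀ r R x ≤ 1 :=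
  min_le_left _ _

end Metric

/-! ### Doubling, and the Poincaré inequality for two level sets -/

section Measurable

variable {X : Type*} [MetricSpace X] [MeasurableSpace X] {μ : Measure X}

/-- The ratio of radii is chosen so close to `1` that decay gives the annulus at most half of the
ball, and this half is absorbed. The maximum with `1` keeps the ratio at least `1/2`, hence
positive. -/
theorem AnnularDecayAt.measure_ball_le_two_mul {C : ℝ} (hC : 0 < C) {x : X}
    (h : AnnularDecayAt μ 1 C x) (hfin : ∀ r : ℝ, 0 < r → μ (Metric.ball x r) < ∞) {R : ℝ}
    (hR : 0 < R) :
    μ (Metric.ball x R) ≤ 2 * μ (Metric.ball x ((1 - 1 / (2 * max C 1)) * R)) := by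
  set D := max C 1
  have hD1 : 1 ≤ D := le_max_right _ _
  have hDC : C ≤ D := le_max_left _ _
  set θ := 1 - 1 / (2 * D)
  have hinv : 0 < 1 / (2 * D) := by positivity
  have hinv' : 1 / (2 * D) ≤ 1 / 2 := by
    rw [div_le_div_iff₀ (by positivity) two_pos]; linarith
  have hθ : 0 < θ := by simp only [θ]; linarith
  have hlt : θ * R < R := by
    have : θ < 1 := by simp only [θ]; linarith
    nlinarith
  have hdec := h (θ * R) R (by positivity) hlt
  have hhalf : C * (1 - θ * R / R) ^ (1 : ℝ) ≤ 1 / 2 := by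
    rw [Real.rpow_one, mul_div_assoc, div_self hR.ne', mul_one]
    calc C * (1 - θ) = C / (2 * D) := by simp only [θ]; ring
      _ ≤ 1 / 2 := by rw [div_le_div_iff₀ (by positivity) two_pos]; linarith
  have hsplit : μ (Metric.ball x R) ≤
      μ (Metric.ball x (θ * R)) + μ (Metric.ball x R \ Metric.ball x (θ * R)) := by
    refine (measure_mono ?_).trans (measure_union_le _ _)
    rw [union_sdiff_cancel (Metric.ball_subset_ball hlt.le)]
  have hM := (hfin R hR).ne
  have hm := (hfin (θ * R) (by positivity)).ne
  have key : μ (Metric.ball x R) ≤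
      μ (Metric.ball x (θ * R)) + ENNReal.ofReal (1 / 2) * μ (Metric.ball x R) :=
    hsplit.trans (add_le_add le_rfl
      (hdec.trans (mul_le_mul' (ENNReal.ofReal_le_ofReal hhalf) le_rfl)))
  lift μ (Metric.ball x R) to NNReal using hM with M
  lift μ (Metric.ball x (θ * R)) to NNReal using hm with m
  have hc : ENNReal.ofReal (1 / 2) = ((1 / 2 : NNReal) : ℝ≥0∞) := by
    rw [ENNReal.ofReal, Real.toNNReal_div zero_le_one]; simp
  rw [hc] at key
  have key' : M ≤ m + 1 / 2 * M := by exact_mod_cast key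
  have : M ≤ 2 * m := by
    have hr : (M : ℝ) ≤ m + 1 / 2 * M := by exact_mod_cast key'
    have : (M : ℝ) ≤ 2 * m := by linarith
    exact_mod_cast this
  exact_mod_cast this

theorem AnnularDecayAt.measure_ball_le_pow_mul {C : ℝ} (hC : 0 < C) {x : X}
    (h : AnnularDecayAt μ 1 C x) (hfin : ∀ r : ℝ, 0 < r → μ (Metric.ball x r) < ∞) (n : ℕ) {R : ℝ}
    (hR : 0 < R) :
    μ (Metric.ball x R) ≤ 2 ^ n * μ (Metric.ball x ((1 - 1 / (2 * max C 1)) ^ n * R)) := by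
  have hθ : 0 < 1 - 1 / (2 * max C 1) := by
    have hD1 : 1 ≤ max C 1 := le_max_right _ _
    have : 1 / (2 * max C 1) ≤ 1 / 2 := by
      rw [div_le_div_iff₀ (by positivity) two_pos]; linarith
    linarith
  induction n with
  | zero => simp
  | succ n ih =>
    refine ih.trans ?_
    rw [pow_succ (2 : ℝ≥0∞), mul_assoc, pow_succ' (1 - 1 / (2 * max C 1)), mul_assoc _ _ R]
    exact mul_le_mul' le_rfl (h.measure_ball_le_two_mul hC hfin (by positivity))

/-- A curve has connected image, so it cannot leave a clopen set. -/
theorem IsClopen.isUpperGradient_indicator {V : Set X} (hV : IsClopen V) :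
    IsUpperGradient (V.indicator 1 : X → ℝ) 0 := by
  refine ⟨measurable_zero, fun γ => ?_⟩
  have hpre : IsPreconnected (γ.toFun '' Icc 0 γ.length) :=
    isPreconnected_Icc.image _ γ.continuousOn
  have h0 : γ.toFun 0 ∈ γ.toFun '' Icc 0 γ.length :=
    mem_image_of_mem _ ⟨le_rfl, γ.length_pos.le⟩
  have hl : γ.toFun γ.length ∈ γ.toFun '' Icc 0 γ.length :=
    mem_image_of_mem _ ⟨γ.length_pos.le, le_rfl⟩
  have hiff : γ.toFun 0 ∈ V ↔ γ.toFun γ.length ∈ V :=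
    ⟨fun h => hpre.subset_isClopen hV ⟨_, h0, h⟩ hl, fun h => hpre.subset_isClopen hV ⟨_, hl, h⟩ h0⟩
  by_cases h : γ.toFun 0 ∈ V
  · simp [UpperGradientIneq, h, hiff.1 h]
  · simp [UpperGradientIneq, h, mt hiff.2 h]

/-- The Poincaré inequality for a function taking the values `1` and `0` on two parts of a ball. -/
theorem PoincareAt.min_measure_le {C lam : ℝ} {x : X} (h : PoincareAt μ 1 C lam x)
    (hlam : 1 ≤ lam) (hball : ∀ r : ℝ, 0 < r → 0 < μ (Metric.ball x r) ∧ μ (Metric.ball x r) < ∞)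
    {r : ℝ} (hr : 0 < r) {f : X → ℝ} {g : X → ℝ≥0∞} (hf : Integrable f μ)
    (hg : IsUpperGradient f g) {E F : Set X} (hEm : MeasurableSet E) (hFm : MeasurableSet F)
    (hE : E ⊆ Metric.ball x r) (hF : F ⊆ Metric.ball x r) (hfE : ∀ y ∈ E, f y = 1)
    (hfF : ∀ y ∈ F, f y = 0) :
    min (μ E) (μ F) ≤ ENNReal.ofReal (2 * C * r) * ∫⁻ y in Metric.ball x (lam * r), g y ∂μ := by
  have hP := h r hr f g hf hg
  set B := Metric.ball x r
  set m := ⨍ z in B, f z ∂μ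
  have hB0 : μ B ≠ 0 := (hball r hr).1.ne'
  have hBt : μ B ≠ ∞ := (hball r hr).2.ne
  simp only [ENNReal.rpow_one, div_one, setLAverage_eq] at hP
  have hmono : μ B ≤ μ (Metric.ball x (lam * r)) :=
    measure_mono (Metric.ball_subset_ball (by nlinarith))
  have hosc : ∫⁻ y in B, ENNReal.ofReal |f y - m| ∂μ ≤
      ENNReal.ofReal (C * r) * ∫⁻ y in Metric.ball x (lam * r), g y ∂μ := by
    have h1 := hP.trans (mul_le_mul' le_rfl (ENNReal.div_le_div_left hmono _))
    rw [← mul_div_assoc, ENNReal.div_le_iff hB0 hBt, ENNReal.div_mul_cancel hB0 hBt] at h1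
    exact h1
  have hone : ∀ {S : Set X} {a : ℝ}, MeasurableSet S → S ⊆ B → (∀ y ∈ S, f y = a) →
      ENNReal.ofReal |a - m| * μ S ≤ ∫⁻ y in B, ENNReal.ofReal |f y - m| ∂μ := by
    intro S a hSm hSB hS
    rw [← setLIntegral_const]
    refine (setLIntegral_congr_fun hSm fun y hy => ?_).trans_le (lintegral_mono_set hSB)
    rw [hS y hy]
  have h1 := hone hEm hE hfE
  have h0 := hone hFm hF hfF
  -- Whatever the mean `m` is, it cannot be close to both values `1` and `0`.
  have hsum : (1 : ℝ≥0∞) ≤ ENNReal.ofReal |1 - m| + ENNReal.ofReal |0 - m| := by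
    rw [← ENNReal.ofReal_add (abs_nonneg _) (abs_nonneg _), ← ENNReal.ofReal_one]
    refine ENNReal.ofReal_le_ofReal ?_
    have := abs_sub_le 1 m 0
    rw [abs_sub_comm m 0] at this
    simpa using this
  calc min (μ E) (μ F)
      ≤ (ENNReal.ofReal |1 - m| + ENNReal.ofReal |0 - m|) * min (μ E) (μ F) :=
        le_mul_of_one_le_left zero_le hsum
    _ ≤ ENNReal.ofReal |1 - m| * μ E + ENNReal.ofReal |0 - m| * μ F := by
        rw [add_mul]
        exact add_le_add (mul_le_mul' le_rfl (min_le_left _ _))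
          (mul_le_mul' le_rfl (min_le_right _ _))
    _ ≤ 2 * (ENNReal.ofReal (C * r) * ∫⁻ y in Metric.ball x (lam * r), g y ∂μ) := by
        rw [two_mul]; exact add_le_add (h1.trans hosc) (h0.trans hosc)
    _ = _ := by
        rw [← mul_assoc, mul_assoc 2 C r, ENNReal.ofReal_mul zero_le_two]; simp

end Measurable

/-! ### Nonempty annuli and the lower bound -/

section Borel

variable {X : Type*} [MetricSpace X] [MeasurableSpace X] [BorelSpace X] {μ : Measure X}

/-- A Poincaré inequality excludes empty annuli inside the space. -/
theorem PoincareAt.exists_mem_annulus {C lam : ℝ} {x : X} (h : PoincareAt μ 1 C lam x)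
    (hlam : 1 ≤ lam)
    (hball : ∀ (x : X) (r : ℝ), 0 < r → 0 < μ (Metric.ball x r) ∧ μ (Metric.ball x r) < ∞)
    {a b : ℝ} (ha : 0 < a) (hab : a < b) {z : X} (hz : b < dist z x) :
    ∃ y, a ≤ dist y x ∧ dist y x < b := by
  by_contra! hempty
  -- An empty annulus makes the ball clopen. Its indicator then has upper gradient zero, although it
  -- is `1` and `0` on two sets of positive measure inside a larger ball.
  have hVeq : Metric.ball x b = Metric.closedBall x a := by
    ext y
    simp only [Metric.mem_ball, Metric.mem_closedBall]
    refine ⟨fun hy => ?_, fun hy => hy.trans_lt hab⟩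
    by_contra! hlt
    exact absurd hy (not_lt.2 (hempty y hlt.le))
  have hclopen : IsClopen (Metric.ball x b) :=
    ⟨by rw [hVeq]; exact Metric.isClosed_closedBall, Metric.isOpen_ball⟩
  have hb : 0 < b := ha.trans hab
  have hint : Integrable ((Metric.ball x b).indicator 1 : X → ℝ) μ :=
    (integrable_indicator_iff Metric.isOpen_ball.measurableSet).2
      (integrableOn_const (hball x b hb).2.ne)
  have hδ : 0 < dist z x - b := sub_pos.2 hz
  have hfar : ∀ y ∈ Metric.ball z (dist z x - b), y ∉ Metric.ball x b := by
    intro y hy hy'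
    rw [Metric.mem_ball] at hy hy'
    have := dist_triangle z y x
    rw [dist_comm z y] at this
    linarith
  have hmin := h.min_measure_le hlam (hball x) (r := 2 * dist z x) (by linarith) hint
    (IsClopen.isUpperGradient_indicator hclopen) (E := Metric.ball x b)
    (F := Metric.ball z (dist z x - b)) Metric.isOpen_ball.measurableSet
    Metric.isOpen_ball.measurableSet (Metric.ball_subset_ball (by linarith))
    (Metric.ball_subset_ball' (by linarith)) (fun y hy => by simp [indicator_of_mem hy])
    (fun y hy => indicator_of_notMem (hfar y hy) _)
  simp only [Pi.zero_apply, lintegral_zero, mul_zero, nonpos_iff_eq_zero, min_eq_iff] at hmin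
  rcases hmin with hmin | hmin
  · exact (hball x b hb).1.ne' hmin.1
  · exact (hball z _ hδ).1.ne' hmin.1

/-- The `1`-capacity type estimate behind the lower bound. -/
theorem measure_ball_le_lintegral_annulus {p C lam C_AD : ℝ} (hp : 1 ≤ p)
    (hlam : 1 ≤ lam) (hC_AD : 0 < C_AD) {n : ℕ}
    (hn : (1 - 1 / (2 * max C_AD 1)) ^ n ≤ 1 / 16)
    (hball : ∀ (x : X) (r : ℝ), 0 < r → 0 < μ (Metric.ball x r) ∧ μ (Metric.ball x r) < ∞)
    (hPI : ∀ x : X, PoincareAt μ 1 C lam x) (hAD : ∀ x : X, AnnularDecayAt μ 1 C_AD x)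
    {x₀ : X} {r R : ℝ} (hR : 0 < R) (hr : R / 2 ≤ r) (hrR : r < R)
    (hdiam : ENNReal.ofReal R ≤ Metric.ediam (univ : Set X) / 3) {u : X → ℝ}
    (hu : Admissible μ p (Metric.ball x₀ r) (Metric.ball x₀ R) u) {g : X → ℝ≥0∞}
    (hg : IsWeakUpperGradient μ p u g) (hgp : ∫⁻ x, g x ^ p ∂μ < ∞) :
    μ (Metric.ball x₀ R) ≤ 2 ^ n * (ENNReal.ofReal (4 * C * R) *
      ∫⁻ x in Metric.ball x₀ R \ Metric.ball x₀ r, g x ∂μ) := by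
  obtain ⟨⟨hum, -, -⟩, hu1, hu0⟩ := hu
  have hdouble : ∀ (x : X) (s : ℝ), 0 < s →
      μ (Metric.ball x s) ≤ 2 ^ n * μ (Metric.ball x (s / 16)) := fun x s hs =>
    ((hAD x).measure_ball_le_pow_mul hC_AD (fun r hr => (hball x r hr).2) n hs).trans
      (mul_le_mul' le_rfl (measure_mono (Metric.ball_subset_ball (by nlinarith))))
  -- `7/5 < 3/2` is what the diameter bound allows; `5/4` keeps `B(y, R/4)` off `B_R`, and `7/5 +
  -- 1/4 < 2` keeps it inside `B_{2R}`.
  obtain ⟨z, hz⟩ := exists_dist_gt_of_ediam (x := x₀) (s := 7 / 5 * R) (by linarith)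
    (by linarith) hdiam
  obtain ⟨y, hy1, hy2⟩ := (hPI x₀).exists_mem_annulus hlam hball (a := 5 / 4 * R)
    (b := 7 / 5 * R) (by linarith) (by linarith) hz
  have hUm : MeasurableSet (Metric.ball x₀ r) := Metric.isOpen_ball.measurableSet
  have hΩm : MeasurableSet (Metric.ball x₀ R) := Metric.isOpen_ball.measurableSet
  have hsub : Metric.ball x₀ r ⊆ Metric.ball x₀ R := Metric.ball_subset_ball hrR.le
  have hone : ∀ x ∈ Metric.ball x₀ r, u x = 1 := fun x hx => by
    have := hu1 x (hsub hx)
    rw [indicator_of_mem hx] at this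
    exact le_antisymm this.2 this.1
  have hint : Integrable u μ := by
    have : u = (Metric.ball x₀ R).indicator u := by
      ext x
      by_cases hx : x ∈ Metric.ball x₀ R
      · rw [indicator_of_mem hx]
      · rw [indicator_of_notMem hx, hu0 x hx]
    rw [this, integrable_indicator_iff hΩm]
    refine IntegrableOn.of_bound (hball x₀ R hR).2 hum.aestronglyMeasurable.restrict 1 ?_
    refine (ae_restrict_iff' hΩm).2 (ae_of_all _ fun x hx => ?_)
    have h := hu1 x hx
    have h0 : (0 : ℝ) ≤ (Metric.ball x₀ r).indicator 1 x :=
      indicator_nonneg (fun _ _ => zero_le_one) x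
    rw [Real.norm_eq_abs, abs_of_nonneg (h0.trans h.1)]
    exact h.2
  obtain ⟨g', ρ, hg'm, hae, hρm, hρ, hug⟩ := hg.exists_isUpperGradient_cutoff hUm hΩm.compl hone
    (d := 0) (fun x hx => hu0 x hx)
  rw [compl_compl] at hug
  set Λ := Metric.ball x₀ (lam * (2 * R))
  set I := ∫⁻ x in Metric.ball x₀ R \ Metric.ball x₀ r, g x ∂μ
  set J := ∫⁻ x in Λ, (g' x + ρ x) ∂μ
  have hΛ : μ Λ < ∞ := (hball x₀ _ (by positivity)).2
  have hJ : J ≠ ∞ := by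
    have hg'p : ∫⁻ x, g' x ^ p ∂μ < ∞ := by
      have : ∫⁻ x, g' x ^ p ∂μ = ∫⁻ x, g x ^ p ∂μ := lintegral_congr_ae (hae.fun_comp (· ^ p))
      rwa [this]
    rw [show J = _ from lintegral_add_left hg'm _]
    exact ENNReal.add_ne_top.2 ⟨(lintegral_lt_top_of_rpow hp hΛ hg'p).ne,
      (lintegral_lt_top_of_rpow hp hΛ hρ).ne⟩
  have hest : ∀ ε : ℝ≥0∞, ε ≠ 0 →
      min (μ (Metric.ball x₀ r)) (μ (Metric.ball y (R / 4))) ≤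
        ENNReal.ofReal (4 * C * R) * (I + ε * J) := by
    intro ε hε
    have h := (hPI x₀).min_measure_le hlam (hball x₀) (r := 2 * R) (by linarith) hint (hug ε hε)
      hUm (F := Metric.ball y (R / 4)) Metric.isOpen_ball.measurableSet
      (Metric.ball_subset_ball (by linarith)) (Metric.ball_subset_ball' (by linarith)) hone
      (fun w hw => hu0 w fun hw' => by
        rw [Metric.mem_ball] at hw hw'
        have := dist_triangle y w x₀
        rw [dist_comm y w] at this
        linarith)
    rw [show 2 * C * (2 * R) = 4 * C * R by ring] at h
    refine h.trans (mul_le_mul' le_rfl ?_)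
    rw [lintegral_add_left (hg'm.indicator (hΩm.diff hUm)), lintegral_const_mul ε (f := fun x => g' x + ρ x) (hg'm.add hρm)]
    refine add_le_add ?_ le_rfl
    refine (setLIntegral_le_lintegral _ _).trans ?_
    rw [lintegral_indicator (hΩm.diff hUm)]
    exact (lintegral_congr_ae (ae_restrict_of_ae hae)).le
  have hlim : min (μ (Metric.ball x₀ r)) (μ (Metric.ball y (R / 4))) ≤
      ENNReal.ofReal (4 * C * R) * I := by
    -- The perturbation disappears as `ε → 0` because `J` is finite.
    have hT : Filter.Tendsto (fun ε : ℝ≥0∞ => ENNReal.ofReal (4 * C * R) * (I + ε * J))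
        (nhdsWithin 0 (Ioi 0)) (nhds (ENNReal.ofReal (4 * C * R) * (I + 0 * J))) := by
      refine ENNReal.Tendsto.const_mul (Filter.Tendsto.const_add _
        (ENNReal.Tendsto.mul_const (Filter.tendsto_id.mono_left nhdsWithin_le_nhds)
          (Or.inr hJ))) (Or.inr ENNReal.ofReal_ne_top)
    rw [zero_mul, add_zero] at hT
    refine ge_of_tendsto hT ?_
    filter_upwards [self_mem_nhdsWithin] with ε hε
    exact hest ε (ne_of_gt hε)
  refine le_trans ?_ (mul_le_mul' le_rfl hlim)
  rw [mul_min]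
  -- One factor `2 ^ n` serves both: `B_{R/16} ⊆ B_r`, and `B_R ⊆ B(y, 4R)` with `4R / 16 = R / 4`.
  refine le_min ((hdouble x₀ R hR).trans (mul_le_mul' le_rfl
    (measure_mono (Metric.ball_subset_ball (by linarith))))) ?_
  have h4 := hdouble y (4 * R) (by linarith)
  rw [show 4 * R / 16 = R / 4 by ring] at h4
  refine (measure_mono (Metric.ball_subset_ball' ?_)).trans h4
  rw [dist_comm]
  linarith

/-- Cancelling `m ^ (p - 1)` isolates the energy `e`; here `δ` stands for `1 - r/R`, `m` for the
measure of the large ball. -/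
theorem le_of_rpow_le_mul_rpow {p m e c k δ R : ℝ} (hp : 1 ≤ p) (hm : 0 < m) (he : 0 ≤ e)
    (hc : 0 < c) (hk : 0 < k) (hδ : 0 < δ) (hR : 0 < R) {A : ℝ}
    (hA : k ^ p * c ^ (p - 1) ≤ A)
    (h : m ^ p ≤ (k * R) ^ p * (e * (c * δ * m) ^ (p - 1))) :
    A⁻¹ * (δ ^ (1 - p) * (m / R ^ p)) ≤ e := by
  have hk' : 0 < k ^ p * c ^ (p - 1) := by positivity
  have hApos : 0 < A := hk'.trans_le hA
  have hmp : m ^ p = m * m ^ (p - 1) := by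
    rw [← Real.rpow_one_add' hm.le (by linarith)]; congr 1; ring
  rw [Real.mul_rpow hk.le hR.le, Real.mul_rpow (by positivity) hm.le, Real.mul_rpow hc.le hδ.le,
    hmp] at h
  have hm1 : 0 < m ^ (p - 1) := Real.rpow_pos_of_pos hm _
  have h2 : m ≤ k ^ p * c ^ (p - 1) * (R ^ p * δ ^ (p - 1) * e) := by
    refine le_of_mul_le_mul_right (h.trans_eq ?_) hm1
    ring
  have hδ' : δ ^ (1 - p) = (δ ^ (p - 1))⁻¹ := by
    rw [← Real.rpow_neg hδ.le]; congr 1; ring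
  have hRp : 0 < R ^ p := Real.rpow_pos_of_pos hR _
  have hδp : 0 < δ ^ (p - 1) := Real.rpow_pos_of_pos hδ _
  rw [hδ', inv_mul_le_iff₀ hApos, inv_mul_le_iff₀ hδp, div_le_iff₀ hRp]
  calc m ≤ k ^ p * c ^ (p - 1) * (R ^ p * δ ^ (p - 1) * e) := h2
    _ ≤ A * (R ^ p * δ ^ (p - 1) * e) := mul_le_mul_of_nonneg_right hA (by positivity)
    _ = _ := by ring

theorem le_variationalCapacity_ball {p C lam C_AD : ℝ} (hp : 1 ≤ p) (hC : 0 < C)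
    (hlam : 1 ≤ lam) (hC_AD : 0 < C_AD) {n : ℕ}
    (hn : (1 - 1 / (2 * max C_AD 1)) ^ n ≤ 1 / 16)
    (hball : ∀ (x : X) (r : ℝ), 0 < r → 0 < μ (Metric.ball x r) ∧ μ (Metric.ball x r) < ∞)
    (hPI : ∀ x : X, PoincareAt μ 1 C lam x) (hAD : ∀ x : X, AnnularDecayAt μ 1 C_AD x)
    {x₀ : X} {r R : ℝ} (hR : 0 < R) (hr : R / 2 ≤ r) (hrR : r < R)
    (hdiam : ENNReal.ofReal R ≤ Metric.ediam (univ : Set X) / 3) {A : ℝ}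
    (hA : (2 ^ n * (4 * C)) ^ p * C_AD ^ (p - 1) ≤ A) :
    ENNReal.ofReal A⁻¹ * (ENNReal.ofReal ((1 - r / R) ^ (1 - p)) *
        (μ (Metric.ball x₀ R) / ENNReal.ofReal (R ^ p))) ≤
      variationalCapacity μ p (Metric.ball x₀ r) (Metric.ball x₀ R) := by
  refine le_iInf₂ fun u hu => le_iInf₂ fun g hg => ?_
  have h1 := measure_ball_le_lintegral_annulus hp hlam hC_AD hn hball hPI hAD hR hr hrR hdiam hu
    hg.1 hg.2
  have hp0 : 0 < p := by linarith
  have hδ : 0 < 1 - r / R := by rw [sub_pos, div_lt_one hR]; exact hrR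
  have hApos : 0 < A := lt_of_lt_of_le (by positivity) hA
  have hdec := hAD x₀ r R (by linarith) hrR
  rw [Real.rpow_one] at hdec
  have hhold := rpow_lintegral_le_mul_measure hp hg.1.1 (Metric.ball x₀ R \ Metric.ball x₀ r)
  have hEmono := lintegral_mono_set (μ := μ) (f := fun x => g x ^ p)
    (sdiff_subset : Metric.ball x₀ R \ Metric.ball x₀ r ⊆ Metric.ball x₀ R)
  have hEfin : ∫⁻ x in Metric.ball x₀ R, g x ^ p ∂μ ≠ ∞ :=
    ((setLIntegral_le_lintegral _ _).trans_lt hg.2).ne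
  have hM0 := (hball x₀ R hR).1
  have hMt := (hball x₀ R hR).2.ne
  set I := ∫⁻ x in Metric.ball x₀ R \ Metric.ball x₀ r, g x ∂μ
  set M := μ (Metric.ball x₀ R)
  set E := ∫⁻ x in Metric.ball x₀ R, g x ^ p ∂μ
  have hMp : M ^ p ≤ ENNReal.ofReal (2 ^ n * (4 * C) * R) ^ p *
      (E * (ENNReal.ofReal (C_AD * (1 - r / R)) * M) ^ (p - 1)) := by
    have h1' : M ≤ ENNReal.ofReal (2 ^ n * (4 * C) * R) * I := by
      refine h1.trans_eq ?_
      rw [← mul_assoc, mul_assoc (2 ^ n : ℝ), ENNReal.ofReal_mul (p := 2 ^ n) (by positivity),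
        ENNReal.ofReal_pow zero_le_two, ENNReal.ofReal_ofNat]
    refine (ENNReal.rpow_le_rpow h1' hp0.le).trans ?_
    rw [ENNReal.mul_rpow_of_nonneg _ _ hp0.le]
    exact mul_le_mul' le_rfl (hhold.trans (mul_le_mul' hEmono
      (ENNReal.rpow_le_rpow hdec (by linarith))))
  obtain ⟨m, hm, hMm⟩ : ∃ m : ℝ, 0 < m ∧ M = ENNReal.ofReal m :=
    ⟨M.toReal, ENNReal.toReal_pos hM0.ne' hMt, (ENNReal.ofReal_toReal hMt).symm⟩
  obtain ⟨e, he, hEe⟩ : ∃ e : ℝ, 0 ≤ e ∧ E = ENNReal.ofReal e :=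
    ⟨E.toReal, ENNReal.toReal_nonneg, (ENNReal.ofReal_toReal hEfin).symm⟩
  rw [hMm, hEe] at hMp
  have hcδ : 0 < C_AD * (1 - r / R) := mul_pos hC_AD hδ
  rw [← ENNReal.ofReal_mul hcδ.le,
    ENNReal.ofReal_rpow_of_pos hm,
    ENNReal.ofReal_rpow_of_pos (show 0 < 2 ^ n * (4 * C) * R by positivity),
    ENNReal.ofReal_rpow_of_pos (mul_pos hcδ hm),
    ← ENNReal.ofReal_mul he, ← ENNReal.ofReal_mul (by positivity),
    ENNReal.ofReal_le_ofReal_iff (by positivity)] at hMp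
  have := le_of_rpow_le_mul_rpow hp hm he hC_AD (by positivity) hδ hR hA hMp
  rw [hMm, hEe, ← ENNReal.ofReal_div_of_pos (by positivity), ← ENNReal.ofReal_mul (by positivity),
    ← ENNReal.ofReal_mul (by positivity)]
  exact ENNReal.ofReal_le_ofReal this

/-! ### The upper bound -/

theorem isUpperGradient_radialCutoff (x₀ : X) {r R : ℝ} (hrR : r < R) :
    IsUpperGradient (radialCutoff x₀ r R) ((Metric.ball x₀ R \ Metric.ball x₀ r).indicator
      fun _ => ENNReal.ofReal (R - r)⁻¹) := by
  refine ⟨measurable_const.indicator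
    (Metric.isOpen_ball.measurableSet.diff Metric.isOpen_ball.measurableSet), fun γ => ?_⟩
  have h := upperGradientIneq_indicator (f := radialCutoff x₀ r R)
    (g := fun _ => ENNReal.ofReal (R - r)⁻¹) γ ?_ ?_
    (U := Metric.ball x₀ r) (V := (Metric.ball x₀ R)ᶜ) (fun x hx => radialCutoff_eq_one hrR hx)
    (fun x hx => radialCutoff_eq_zero hrR hx)
  · rwa [compl_compl] at h
  · intro s t hs hst ht
    have hpos : 0 ≤ (R - r)⁻¹ := (inv_pos.2 (sub_pos.2 hrR)).le
    rw [setLIntegral_const, Real.volume_Icc, ← ENNReal.ofReal_mul hpos]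
    exact ENNReal.ofReal_le_ofReal ((abs_radialCutoff_sub_le x₀ hrR _ _).trans
      (mul_le_mul_of_nonneg_left (γ.dist_le hs hst ht) hpos))
  · rw [Curve.lineIntegral, setLIntegral_const]
    exact ENNReal.mul_ne_top ENNReal.ofReal_ne_top (by simp)

theorem variationalCapacity_ball_le {p C_AD : ℝ} (hp : 1 ≤ p) (hC_AD : 0 < C_AD) {x₀ : X}
    (hfin : ∀ r : ℝ, 0 < r → μ (Metric.ball x₀ r) < ∞) (hAD : AnnularDecayAt μ 1 C_AD x₀)
    {r R : ℝ} (hr : 0 < r) (hrR : r < R) :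
    variationalCapacity μ p (Metric.ball x₀ r) (Metric.ball x₀ R) ≤
      ENNReal.ofReal C_AD * (ENNReal.ofReal ((1 - r / R) ^ (1 - p)) *
        (μ (Metric.ball x₀ R) / ENNReal.ofReal (R ^ p))) := by
  have hp0 : 0 < p := by linarith
  have hR : 0 < R := hr.trans hrR
  have hsub : 0 < R - r := sub_pos.2 hrR
  have hδ : 0 < 1 - r / R := by rw [sub_pos, div_lt_one hR]; exact hrR
  have hSm : MeasurableSet (Metric.ball x₀ R \ Metric.ball x₀ r) :=
    Metric.isOpen_ball.measurableSet.diff Metric.isOpen_ball.measurableSet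
  set S := Metric.ball x₀ R \ Metric.ball x₀ r
  set u := radialCutoff x₀ r R
  set g : X → ℝ≥0∞ := S.indicator fun _ => ENNReal.ofReal (R - r)⁻¹
  have hug : IsUpperGradient u g := isUpperGradient_radialCutoff x₀ hrR
  have hgp : ∫⁻ x, g x ^ p ∂μ = ENNReal.ofReal ((R - r)⁻¹ ^ p) * μ S := by
    have : ∀ x, g x ^ p = S.indicator (fun _ => ENNReal.ofReal ((R - r)⁻¹ ^ p)) x := fun x => by
      by_cases hx : x ∈ S
      · simp only [g, indicator_of_mem hx]
        rw [ENNReal.ofReal_rpow_of_pos (inv_pos.2 hsub)]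
      · simp only [g, indicator_of_notMem hx, ENNReal.zero_rpow_of_pos hp0]
    simp_rw [this]
    rw [lintegral_indicator hSm, setLIntegral_const]
  have hSfin : μ S < ∞ := (measure_mono sdiff_subset).trans_lt (hfin R hR)
  have hgfin : ∫⁻ x, g x ^ p ∂μ < ∞ := by
    rw [hgp]; exact ENNReal.mul_lt_top ENNReal.ofReal_lt_top hSfin
  have hucont : Continuous u := by
    simp only [u]; unfold radialCutoff; fun_prop
  have huLp : ∫⁻ x, ENNReal.ofReal |u x| ^ p ∂μ < ∞ := by
    refine lt_of_le_of_lt (lintegral_mono (g := (Metric.ball x₀ R).indicator 1) fun x => ?_) ?_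
    · by_cases hx : x ∈ Metric.ball x₀ R
      · rw [indicator_of_mem hx, Pi.one_apply, abs_of_nonneg (radialCutoff_nonneg _ _ _ _)]
        exact ENNReal.rpow_le_one (ENNReal.ofReal_le_one.2 (radialCutoff_le_one _ _ _ _)) hp0.le
      · simp only [indicator_of_notMem hx]
        rw [show u x = 0 from radialCutoff_eq_zero hrR hx]
        simp [hp0]
    · rw [lintegral_indicator_one Metric.isOpen_ball.measurableSet]
      exact hfin R hR
  have hadm : Admissible μ p (Metric.ball x₀ r) (Metric.ball x₀ R) u := by
    refine ⟨⟨hucont.measurable.aemeasurable, huLp, g, hug, hgfin⟩,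
      fun x _ => ⟨?_, radialCutoff_le_one _ _ _ _⟩, fun x hx => radialCutoff_eq_zero hrR hx⟩
    by_cases hx : x ∈ Metric.ball x₀ r
    · rw [indicator_of_mem hx]; exact (radialCutoff_eq_one hrR hx).ge
    · rw [indicator_of_notMem hx]; exact radialCutoff_nonneg _ _ _ _
  have hweak : IsWeakUpperGradient μ p u g := by
    refine ⟨hug.1.aemeasurable, 0, measurable_zero, by simp [hp0], fun γ hγ => ?_⟩
    exact absurd (hug.2 γ) hγ
  have hdec := hAD r R hr hrR
  rw [Real.rpow_one] at hdec
  calc variationalCapacity μ p (Metric.ball x₀ r) (Metric.ball x₀ R)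
      ≤ energy μ p (Metric.ball x₀ R) u := iInf₂_le u hadm
    _ ≤ ∫⁻ x in Metric.ball x₀ R, g x ^ p ∂μ := iInf₂_le g ⟨hweak, hgfin⟩
    _ ≤ ENNReal.ofReal ((R - r)⁻¹ ^ p) * μ S := hgp ▸ setLIntegral_le_lintegral _ _
    _ ≤ ENNReal.ofReal ((R - r)⁻¹ ^ p) *
        (ENNReal.ofReal (C_AD * (1 - r / R)) * μ (Metric.ball x₀ R)) := mul_le_mul' le_rfl hdec
    _ = _ := by
      rw [div_eq_mul_inv (μ _), ← ENNReal.ofReal_inv_of_pos (by positivity), mul_comm (μ _),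
        ← mul_assoc, ← mul_assoc, ← mul_assoc, ← ENNReal.ofReal_mul (by positivity),
        ← ENNReal.ofReal_mul hC_AD.le, ← ENNReal.ofReal_mul (by positivity)]
      congr 2
      have : R - r = (1 - r / R) * R := by field_simp
      rw [this, mul_inv, Real.mul_rpow (by positivity) (by positivity), Real.inv_rpow hδ.le,
        Real.inv_rpow hR.le, sub_eq_add_neg 1 p, Real.rpow_add hδ, Real.rpow_one,
        Real.rpow_neg hδ.le]
      ring

end Borel

end ThinAnnuli

/-! ### Choice of the constant -/

theorem theorem1p3 (p : ℝ) (hp : 1 ≤ p) (C_PI lam C_AD : ℝ)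
    (hC_PI : 0 < C_PI) (hlam : 1 ≤ lam) (hC_AD : 0 < C_AD) :
    ∃ A : ℝ, 0 < A ∧
      ∀ (X : Type*) [MetricSpace X] [MeasurableSpace X] [BorelSpace X] (μ : Measure X),
        (∀ (x : X) (r : ℝ), 0 < r → 0 < μ (Metric.ball x r) ∧ μ (Metric.ball x r) < ∞) →
        (∀ x : X, ThinAnnuli.PoincareAt μ 1 C_PI lam x) →
        (∀ x : X, ThinAnnuli.AnnularDecayAt μ 1 C_AD x) →
        ∀ (x₀ : X) (r R : ℝ), 0 < R / 2 → R / 2 ≤ r → r < R →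
          ENNReal.ofReal R ≤ Metric.ediam (univ : Set X) / 3 →
          ENNReal.ofReal A⁻¹ *
              (ENNReal.ofReal ((1 - r / R) ^ (1 - p)) *
                (μ (Metric.ball x₀ R) / ENNReal.ofReal (R ^ p)))
            ≤ ThinAnnuli.variationalCapacity μ p (Metric.ball x₀ r) (Metric.ball x₀ R) ∧
          ThinAnnuli.variationalCapacity μ p (Metric.ball x₀ r) (Metric.ball x₀ R)
            ≤ ENNReal.ofReal A *
              (ENNReal.ofReal ((1 - r / R) ^ (1 - p)) *
                (μ (Metric.ball x₀ R) / ENNReal.ofReal (R ^ p))) := by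
  obtain ⟨n, hn⟩ := exists_pow_lt_of_lt_one (x := (1 / 16 : ℝ))
    (y := 1 - 1 / (2 * max C_AD 1)) (by norm_num)
    (by have : 0 < 1 / (2 * max C_AD 1) := by positivity
        linarith)
  refine ⟨max ((2 ^ n * (4 * C_PI)) ^ p * C_AD ^ (p - 1)) C_AD, lt_max_of_lt_right hC_AD, ?_⟩
  intro X _ _ _ μ hball hPI hAD x₀ r R hR hr hrR hdiam
  refine ⟨ThinAnnuli.le_variationalCapacity_ball hp hC_PI hlam hC_AD hn.le hball hPI hAD
    (by linarith) hr hrR hdiam (le_max_left _ _), ?_⟩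
  exact (ThinAnnuli.variationalCapacity_ball_le hp hC_AD (fun r hr => (hball x₀ r hr).2) (hAD x₀)
    (by linarith) hrR).trans (mul_le_mul' (ENNReal.ofReal_le_ofReal (le_max_right _ _)) le_rfl)
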